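/- Let $p\ge 2$ and $r\ge 1$ be integers, let $A\in M_d(\mathbb C)$, and let $P(z)=z^r-a_0z^{r-1}-\cdots-a_{r-1}$ be a complex polynomial with $a_{r-1}\neq 0$ and $P(A)=0$. Write $P(z)=\prod_{i=1}^{l}(z-\lambda_i)^{m_i}$ with pairwise distinct $\lambda_i$ and $m_i\ge 1$, and put $\Delta_1=\{i: m_i=1\}$, $\Delta_2=\{i: m_i>1\}$. Let $P_0=1$, $P_{j+1}(z)=zP_j(z)-a_j$, and $A_s=P_s(A)$ $(0\le s\le r-1)$. Let $(u_n)_{n\ge -r+1}$ be given by $u_n=0$ for $n<0$, $u_0=1$ and $u_{n+1}=a_0u_n+\cdots+a_{r-1}u_{n-r+1}$ for $n\ge 0$. For $1\le i\le l$ and $0\le j\le m_i-1$ set $$\gamma^{[i]}_j=(-1)^{r-m_i}\sum_{\substack{(n_t)_{t\ne i},\ n_t\ge 0\\ \sum_{t\neq i} n_t=m_i-j-1}}\ \prod_{t\ne i}\frac{\binom{n_t+m_t-1}{n_t}}{(\lambda_t-\lambda_i)^{n_t+m_t}}\quad(l>1),$$ and, if $l=1$, $\gamma^{[1]}_{r-1}=1$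 and $\gamma^{[1]}_j=0$ for $j\ne r-1$. Set $$C_{i,j}=\sum_{h=j}^{m_i-1}\lambda_i^{r-1-h}\gamma^{[i]}_h\sum_{k=j}^{h}\binom{r-1}{h-k}\frac{S_{k,j}}{k!},$$ where $S_{k,j}$ are the (signed) Stirling numbers of the first kind, $x(x-1)\cdots(x-k+1)=\sum_j S_{k,j}x^j$, and $$\tilde C_i=\frac{(-1)^{r-1}\lambda_i^{r-1}}{\prod_{t\ne i}(\lambda_t-\lambda_i)^{m_t}}\ (i\in\Delta_1),\qquad \tilde C_i=\sum_{h=0}^{m_i-1}\lambda_i^{r-1-h}\gamma_h^{[i]}\binom{r-1}{h}\ (i\in\Delta_2).$$ Then these are the Binet coefficients of $(u_n)$: $u_n=\sum_{i=1}^l\sum_{j=0}^{m_i-1}C_{i,j}n^j\lambda_i^n$ for all $n\ge 0$ (with $0^0=1$), and $\tilde C_i=C_{i,0}$ for all $i$. Moreover, for every real $t\ne 0$ with $|t|\rho(A)<1$, where $\rho$ is the spectral radius, $$(I-tA)^{1/p}=\varphi_0(t)I+\sum_{s=1}^{r-1}\bigl[\Phi_s(t)+\Psi_s(t)\bigr]A_s,$$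 where, with $D=t\frac{d}{dt}$ and the principal branch of $z^{1/p}$, $$\varphi_0(t)=\sum_{i\in\Delta_1\cup\Delta_2}\tilde C_i(1-\lambda_it)^{1/p}+\sum_{i\in\Delta_2}\sum_{j=1}^{m_i-1}C_{i,j}D^j(1-\lambda_it)^{1/p},$$ $$\Phi_s(t)=\sum_{i\in\Delta_1\cup\Delta_2}\frac{\tilde C_i}{\lambda_i^s}(1-\lambda_it)^{1/p},\qquad \Psi_s(t)=\sum_{i\in\Delta_2}\sum_{j=1}^{m_i-1}\sum_{k=0}^{j}\frac{C_{i,j}}{\lambda_i^s}\binom jk(-s)^{j-k}D^k(1-\lambda_it)^{1/p}.$$ Here the equality means that the right-hand side is the sum of the convergent series $\sum_{n\ge0}b_nt^nA^n$, where $b_n=(-1)^n\frac{\frac1p(\frac1p-1)\cdots(\frac1p-n+1)}{n!}$ are the Taylor coefficients of $(1-z)^{1/p}=\sum_n b_nz^n$, and that it is the principal $p$th root of $I-tA$: its $p$th power is $I-tA$ and all its eigenvalues lie in $\{z\ne0:|\arg z|<\pi/p\}$. (If $\lambda_it=1$ for some $i$, which can happen only when $\lambda_i$ is not an eigenvalue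 of $A$, then $D^k(1-\lambda_it)^{1/p}$ with $k\ge1$ does not exist at that $t$ and is read as $0$.) -/

import Mathlib

namespace PthRoot

open Polynomial

noncomputable section

/-- The Taylor coefficients `b n` of `(1 - z)^(1/p) = ∑ b n z^n`, namely
`b n = (-1)^n (1/p) (1/p - 1) ⋯ (1/p - n + 1) / n!`. -/
def taylorCoeff (p n : ℕ) : ℂ :=
  (-1) ^ n * (∏ q ∈ Finset.range n, (1 / (p : ℂ) - (q : ℂ))) / (n.factorial : ℂ)

/-- `X` is the principal `p`th root of `B`: it is a `p`th root all of whose eigenvalues lie in the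
open sector `{z ≠ 0 : |arg z| < π / p}`. -/
def IsPrincipalRoot {d : ℕ} (p : ℕ) (B X : Matrix (Fin d) (Fin d) ℂ) : Prop :=
  X ^ p = B ∧ ∀ z ∈ spectrum ℂ X, z ≠ 0 ∧ |Complex.arg z| < Real.pi / p

/-- `P(z) = z^r - a 0 z^(r-1) - ⋯ - a (r-1)`. Only the values `a 0, …, a (r-1)` matter. -/
def annihPoly (r : ℕ) (a : ℕ → ℂ) : ℂ[X] :=
  X ^ r - ∑ q ∈ Finset.range r, C (a q) * X ^ (r - 1 - q)

/-- The Hörner polynomials: `P_0 = 1`, `P_{j+1} = z P_j - a j`. -/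
def hornerPoly (a : ℕ → ℂ) : ℕ → ℂ[X]
  | 0 => 1
  | j + 1 => X * hornerPoly a j - C (a j)

/-- The Hörner system `A_s = P_s(A)`. -/
def hornerMatrix {d : ℕ} (a : ℕ → ℂ) (A : Matrix (Fin d) (Fin d) ℂ) (s : ℕ) :
    Matrix (Fin d) (Fin d) ℂ :=
  aeval A (hornerPoly a s)

/-- The sequence `u 0 = 1`, `u (n+1) = a 0 u n + ⋯ + a (r-1) u (n-r+1)`, where `u` vanishes at the
negative integers (so only the indices `k < r` with `k ≤ n` contribute to the sum). -/
def fibSeq (r : ℕ) (a : ℕ → ℂ) : ℕ → ℂ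
  | 0 => 1
  | n + 1 => ∑ k : Fin (n + 1), if (k : ℕ) < r then a k * fibSeq r a (n - k) else 0

/-- The signed Stirling numbers of the first kind:
`x (x - 1) ⋯ (x - k + 1) = ∑ j, stirling k j * x ^ j`. -/
def stirling (k j : ℕ) : ℂ :=
  (-1) ^ (k + j) * (Nat.stirlingFirst k j : ℂ)

/-- The numbers `γ_j^{[i]}`. For `l ≠ 1` the sum runs over the families `(n_t)_{t ≠ i}` of natural
numbers with sum `m i - j - 1`. -/
def gammaCoeff (r : ℕ) {l : ℕ} (lam : Fin l → ℂ) (m : Fin l → ℕ) (i : Fin l) (j : ℕ) : ℂ :=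
  if l = 1 then (if j = r - 1 then 1 else 0)
  else (-1) ^ (r - m i) *
    ∑ n ∈ Finset.piAntidiag (Finset.univ.erase i) (m i - j - 1),
      ∏ t ∈ Finset.univ.erase i,
        ((n t + m t - 1).choose (n t) : ℂ) / (lam t - lam i) ^ (n t + m t)

/-- The Binet coefficients `C_{i,j}`. -/
def binetCoeff (r : ℕ) {l : ℕ} (lam : Fin l → ℂ) (m : Fin l → ℕ) (i : Fin l) (j : ℕ) : ℂ :=
  ∑ h ∈ Finset.Icc j (m i - 1), lam i ^ (r - 1 - h) * gammaCoeff r lam m i h *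
    ∑ k ∈ Finset.Icc j h, ((r - 1).choose (h - k) : ℂ) * (stirling k j / (k.factorial : ℂ))

/-- `Δ₁`: the indices of the simple roots. -/
def simpleIdx {l : ℕ} (m : Fin l → ℕ) : Finset (Fin l) := Finset.univ.filter fun i => m i = 1

/-- `Δ₂`: the indices of the multiple roots. -/
def multipleIdx {l : ℕ} (m : Fin l → ℕ) : Finset (Fin l) := Finset.univ.filter fun i => 1 < m i

/-- The coefficients `C̃_i`. -/
def binetCoeffTilde (r : ℕ) {l : ℕ} (lam : Fin l → ℂ) (m : Fin l → ℕ) (i : Fin l) : ℂ :=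
  if i ∈ simpleIdx m then
    (-1) ^ (r - 1) * lam i ^ (r - 1) / ∏ t ∈ Finset.univ.erase i, (lam t - lam i) ^ m t
  else
    ∑ h ∈ Finset.range (m i), lam i ^ (r - 1 - h) * gammaCoeff r lam m i h *
      ((r - 1).choose h : ℂ)

/-- The function `t ↦ (1 - μ t)^(1/p)` of a real variable (principal branch). -/
def rootFun (p : ℕ) (μ : ℂ) (t : ℝ) : ℂ := (1 - μ * (t : ℂ)) ^ (1 / (p : ℂ))

/-- The differential operator `D = t d/dt`. -/
def eulerOp (f : ℝ → ℂ) (t : ℝ) : ℂ := (t : ℂ) * deriv f t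

/-- `φ₀(t)`. -/
def phiZero (p r : ℕ) {l : ℕ} (lam : Fin l → ℂ) (m : Fin l → ℕ) (t : ℝ) : ℂ :=
  (∑ i ∈ simpleIdx m ∪ multipleIdx m, binetCoeffTilde r lam m i * rootFun p (lam i) t) +
    ∑ i ∈ multipleIdx m, ∑ j ∈ Finset.Icc 1 (m i - 1),
      binetCoeff r lam m i j * (eulerOp^[j] (rootFun p (lam i))) t

/-- `Φ_s(t)`. -/
def bigPhi (p r : ℕ) {l : ℕ} (lam : Fin l → ℂ) (m : Fin l → ℕ) (s : ℕ) (t : ℝ) : ℂ :=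
  ∑ i ∈ simpleIdx m ∪ multipleIdx m,
    binetCoeffTilde r lam m i / lam i ^ s * rootFun p (lam i) t

/-- `Ψ_s(t)`. -/
def bigPsi (p r : ℕ) {l : ℕ} (lam : Fin l → ℂ) (m : Fin l → ℕ) (s : ℕ) (t : ℝ) : ℂ :=
  ∑ i ∈ multipleIdx m, ∑ j ∈ Finset.Icc 1 (m i - 1), ∑ k ∈ Finset.range (j + 1),
    binetCoeff r lam m i j / lam i ^ s * (j.choose k : ℂ) * (-(s : ℂ)) ^ (j - k) *
      (eulerOp^[k] (rootFun p (lam i))) t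

/-- The matrix `φ₀(t) I + ∑_{s=1}^{r-1} [Φ_s(t) + Ψ_s(t)] A_s`. -/
def binetHornerMatrix (p r : ℕ) {l : ℕ} (lam : Fin l → ℂ) (m : Fin l → ℕ) (a : ℕ → ℂ) {d : ℕ}
    (A : Matrix (Fin d) (Fin d) ℂ) (t : ℝ) : Matrix (Fin d) (Fin d) ℂ :=
  phiZero p r lam m t • (1 : Matrix (Fin d) (Fin d) ℂ) +
    ∑ s ∈ Finset.Icc 1 (r - 1), (bigPhi p r lam m s t + bigPsi p r lam m s t) • hornerMatrix a A s

end

end PthRoot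

namespace PthRoot

open Polynomial

noncomputable section

/-! Everything rests on the functional `residue P`, algebraically the sum of the residues of f/P. It
kills multiples of P, so n ↦ `residue P (X ^ (n + r - 1))` obeys the recurrence of u and equals it
(`fibSeq_eq_residue`). The Hörner polynomials are dual to the monomials for it, so whenever P(x) = 0
every f(x) is a combination of the P_s(x) with residues as coefficients
(`aeval_eq_sum_residue_smul_hornerPoly`).

Partial fractions of 1/P, whose coefficients are the γ's, give polynomials e_i summing to 1
(`sum_idempotentPoly`). The residue of e_i X^N is a sum of γ_h binom(N,h) λ_i^(N-h). Vandermonde and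
Stirling numbers turn it into the Binet term of λ_i, shifted by s
(`residue_idempotentPoly_mul_X_pow_eq_binet`). With duality, this writes x^n as a sum of n^k λ_i^n
times fixed elements of the algebra (`pow_eq_sum_componentCoeff`). Summing against b_n t^n replaces
n^k λ_i^n by D^k(1-λ_i t)^(1/p). Elements belonging to a λ_i outside the spectrum vanish, so only
|λ_i t| < 1 on the spectrum is needed (`hasSum_taylorCoeff_smul_pow`).

The pth power is computed by Cauchy products from the formal identity (Σ b_n X^n)^p = 1 - X. For the
eigenvalues, the right-hand side is q(A) for a polynomial q; applying the same series theorem in the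
algebra ℂ at an eigenvalue μ gives q(μ) = (1-μt)^(1/p), and spectral mapping concludes. -/

/-! ### The residue functional -/

/-- The residue functional of `P`: the coefficient of `X ^ (deg P - 1)` in the remainder modulo
`P`. -/
def residue (P : ℂ[X]) : ℂ[X] →ₗ[ℂ] ℂ :=
  (lcoeff ℂ (P.natDegree - 1)).comp (modByMonicHom P)

lemma residue_apply (P f : ℂ[X]) : residue P f = (f %ₘ P).coeff (P.natDegree - 1) := rfl

lemma residue_self_mul {P : ℂ[X]} (hP : P.Monic) (f : ℂ[X]) : residue P (P * f) = 0 := by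
  simp [residue_apply, self_mul_modByMonic hP]

lemma residue_of_degree_lt {P f : ℂ[X]} (hP : P.Monic) (h : f.degree < P.degree) :
    residue P f = f.coeff (P.natDegree - 1) := by
  rw [residue_apply, (modByMonic_eq_self_iff hP).2 h]

/-- The remainder of Q f modulo P Q is Q times the remainder of f modulo P, and a monic Q preserves
the top coefficient: a common factor of f/P cancels. -/
lemma residue_mul_mul {P Q : ℂ[X]} (hP : P.Monic) (hQ : Q.Monic) (hdeg : 1 ≤ P.natDegree)
    (f : ℂ[X]) : residue (P * Q) (Q * f) = residue P f := by
  have hP1 : P ≠ 1 := by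
    rintro rfl
    simp at hdeg
  have hlt := degree_modByMonic_lt f hP
  have hsplit : Q * f = Q * (f %ₘ P) + P * Q * (f /ₘ P) := by
    conv_lhs => rw [← modByMonic_add_div f P]
    ring
  rw [hsplit, map_add, residue_self_mul (hP.mul hQ), add_zero, residue_of_degree_lt (hP.mul hQ),
    hP.natDegree_mul hQ, residue_apply]
  · have h1 : P.natDegree + Q.natDegree - 1 = Q.natDegree + (P.natDegree - 1) := by omega
    rw [h1, coeff_mul_add_eq_of_natDegree_le le_rfl
      (Nat.le_sub_one_of_lt (natDegree_modByMonic_lt f hP hP1)), hQ.coeff_natDegree, one_mul]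
  · rw [degree_mul, degree_mul, add_comm]
    exact WithBot.add_lt_add_right (degree_ne_bot.2 hQ.ne_zero) hlt

/-- Expand X^n in powers of X - μ: only the power h has nonzero residue. If n < h, the binomial
coefficient is zero and the truncated exponent is harmless. -/
lemma residue_X_sub_C_pow_X_pow (μ : ℂ) (h n : ℕ) :
    residue ((X - C μ) ^ (h + 1)) (X ^ n) = (n.choose h : ℂ) * μ ^ (n - h) := by
  have hmon : ∀ k, ((X - C μ) ^ k).Monic := fun k => (monic_X_sub_C μ).pow k
  have hdeg : ((X - C μ) ^ (h + 1)).natDegree = h + 1 := by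
    rw [natDegree_pow, natDegree_X_sub_C, mul_one]
  have hX : (X : ℂ[X]) ^ n =
      ∑ k ∈ Finset.range (n + 1), (μ ^ (n - k) * n.choose k) • (X - C μ) ^ k := by
    conv_lhs => rw [← sub_add_cancel X (C μ), add_pow]
    refine Finset.sum_congr rfl fun k _ => ?_
    rw [smul_eq_C_mul, C_mul, C_pow, C_eq_natCast]
    ring
  have hk : ∀ k, residue ((X - C μ) ^ (h + 1)) ((X - C μ) ^ k) = if k = h then 1 else 0 := by
    intro k
    rcases lt_or_ge h k with hlt | hle
    · obtain ⟨e, rfl⟩ := Nat.exists_eq_add_of_lt hlt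
      rw [show h + e + 1 = h + 1 + e by omega, pow_add (X - C μ) (h + 1) e,
        residue_self_mul (hmon _), if_neg (by omega)]
    · rw [residue_of_degree_lt (hmon _), hdeg, Nat.add_sub_cancel]
      · split_ifs with he
        · subst he
          have := (hmon k).coeff_natDegree
          rwa [natDegree_pow, natDegree_X_sub_C, mul_one] at this
        · apply coeff_eq_zero_of_natDegree_lt
          rw [natDegree_pow, natDegree_X_sub_C]
          omega
      · rw [degree_pow, degree_pow, degree_X_sub_C]
        simp only [nsmul_eq_mul, mul_one]
        exact_mod_cast Nat.lt_succ_of_le hle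
  rw [hX, map_sum]
  simp only [map_smul, hk, smul_eq_mul, mul_ite, mul_one, mul_zero]
  rw [Finset.sum_ite_eq' (Finset.range (n + 1)) h]
  split_ifs with hm
  · ring
  · rw [Finset.mem_range, not_lt] at hm
    rw [Nat.choose_eq_zero_of_lt hm]
    simp

/-! ### The recurrence and duality of the Hörner polynomials -/

section Horner

variable {r : ℕ} {a : ℕ → ℂ}

lemma degree_annihPoly_tail_lt (hr : 1 ≤ r) :
    (∑ q ∈ Finset.range r, C (a q) * X ^ (r - 1 - q)).degree < (r : WithBot ℕ) := by
  rw [← mem_degreeLT]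
  refine Submodule.sum_mem _ fun q _ => mem_degreeLT.2 ?_
  refine lt_of_le_of_lt (degree_C_mul_X_pow_le _ _) ?_
  exact_mod_cast (by omega : r - 1 - q < r)

lemma monic_annihPoly (hr : 1 ≤ r) : (annihPoly r a).Monic :=
  monic_X_pow_sub (degree_annihPoly_tail_lt hr)

lemma natDegree_annihPoly (hr : 1 ≤ r) : (annihPoly r a).natDegree = r := by
  rw [annihPoly, natDegree_eq_of_degree_eq (q := (X : ℂ[X]) ^ r), natDegree_X_pow]
  apply degree_sub_eq_left_of_degree_lt
  rw [degree_X_pow]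
  exact degree_annihPoly_tail_lt hr

lemma hornerPoly_eq_annihPoly (a : ℕ → ℂ) (s : ℕ) : hornerPoly a s = annihPoly s a := by
  induction s with
  | zero => simp [hornerPoly, annihPoly]
  | succ s ih =>
    rw [hornerPoly, ih, annihPoly, annihPoly, Finset.sum_range_succ, mul_sub, Finset.mul_sum,
      ← pow_succ', sub_sub]
    congr 2
    · refine Finset.sum_congr rfl fun q hq => ?_
      rw [Finset.mem_range] at hq
      rw [mul_left_comm, ← pow_succ']
      congr 2
      omega
    · simp

lemma residue_annihPoly_X_pow_mul (hr : 1 ≤ r) (f : ℂ[X]) :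
    residue (annihPoly r a) (X ^ r * f) =
      ∑ q ∈ Finset.range r, a q * residue (annihPoly r a) (X ^ (r - 1 - q) * f) := by
  have h := residue_self_mul (monic_annihPoly (a := a) hr) f
  have h2 : X ^ r * f = annihPoly r a * f +
      ∑ q ∈ Finset.range r, a q • (X ^ (r - 1 - q) * f) := by
    rw [annihPoly, sub_mul, Finset.sum_mul]
    simp only [smul_eq_C_mul, mul_assoc]
    ring
  rw [h2, map_add, h, zero_add, map_sum]
  simp

lemma residue_annihPoly_X_pow (hr : 1 ≤ r) {e : ℕ} (he : e < r) :
    residue (annihPoly r a) (X ^ e) = if e = r - 1 then 1 else 0 := by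
  rw [residue_of_degree_lt (monic_annihPoly hr), natDegree_annihPoly hr, coeff_X_pow]
  · simp [eq_comm]
  · rw [degree_X_pow, degree_eq_natDegree (monic_annihPoly hr).ne_zero, natDegree_annihPoly hr]
    exact_mod_cast he

lemma fibSeq_eq_residue (hr : 1 ≤ r) (n : ℕ) :
    fibSeq r a n = residue (annihPoly r a) (X ^ (n + r - 1)) := by
  induction n using Nat.strong_induction_on with
  | _ n ih =>
    cases n with
    | zero => rw [zero_add, residue_annihPoly_X_pow hr (by omega), if_pos rfl, fibSeq]
    | succ n =>
      rw [fibSeq, Fin.sum_univ_eq_sum_range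
        (fun k => if k < r then a k * fibSeq r a (n - k) else 0) (n + 1),
        ← Finset.sum_filter, show n + 1 + r - 1 = r + n by omega, pow_add,
        residue_annihPoly_X_pow_mul hr]
      -- The indices k > n, where u would have a negative argument, give monomials of degree below r
      -- - 1, whose residue is 0.
      refine Finset.sum_subset_zero_on_sdiff (fun k hk => ?_) (fun k hk => ?_) (fun k hk => ?_)
      · simp only [Finset.mem_filter, Finset.mem_range] at hk ⊢
        exact hk.2
      · simp only [Finset.mem_sdiff, Finset.mem_filter, Finset.mem_range] at hk
        rw [← pow_add, residue_annihPoly_X_pow hr (by omega), if_neg (by omega), mul_zero]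
      · simp only [Finset.mem_filter, Finset.mem_range] at hk
        rw [ih (n - k) (by omega), ← pow_add]
        congr 3
        omega

/-- The values at `x` of the Hörner polynomials are dual to the monomials with respect to the
residue functional. -/
lemma aeval_eq_sum_residue_smul_hornerPoly {𝔸 : Type*} [Ring 𝔸] [Algebra ℂ 𝔸] (hr : 1 ≤ r)
    {x : 𝔸} (hx : aeval x (annihPoly r a) = 0) (f : ℂ[X]) :
    aeval x f = ∑ s ∈ Finset.range r,
      residue (annihPoly r a) (X ^ (r - 1 - s) * f) • aeval x (hornerPoly a s) := by
  induction f using Polynomial.induction_on' with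
  | add f g hf hg => simp only [map_add, mul_add, add_smul, Finset.sum_add_distrib, ← hf, ← hg]
  | monomial n c =>
    rw [← C_mul_X_pow_eq_monomial, ← smul_eq_C_mul, map_smul]
    simp only [mul_smul_comm, map_smul, smul_assoc, ← Finset.smul_sum]
    congr 1
    induction n with
    | zero =>
      rw [Finset.sum_eq_single_of_mem 0 (Finset.mem_range.2 hr)]
      · rw [pow_zero, mul_one, residue_annihPoly_X_pow hr (by omega)]
        simp [hornerPoly]
      · intro s hs hs0
        rw [Finset.mem_range] at hs
        rw [pow_zero, mul_one, residue_annihPoly_X_pow hr (by omega), if_neg (by omega), zero_smul]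
    | succ n ih =>
      -- Multiplication by x raises s by one. The top term vanishes since P_r(x) = P(x) = 0, and the
      -- constants a_s add up, by the recurrence, to the new coefficient of P_0.
      have hstep : ∀ s, x * aeval x (hornerPoly a s) =
          aeval x (hornerPoly a (s + 1)) + a s • (1 : 𝔸) := by
        intro s
        simp [hornerPoly, Algebra.algebraMap_eq_smul_one]
      obtain ⟨k, rfl⟩ := Nat.exists_eq_add_of_le' hr
      rw [pow_succ', map_mul, aeval_X, ih, Finset.mul_sum]
      simp only [mul_smul_comm, hstep, smul_add, Finset.sum_add_distrib]
      rw [Finset.sum_range_succ, Finset.sum_range_succ' (fun s =>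
        residue (annihPoly (k + 1) a) (X ^ (k + 1 - 1 - s) * (X * X ^ n)) •
          aeval x (hornerPoly a s)), hornerPoly_eq_annihPoly a (k + 1), hx, smul_zero, add_zero]
      congr 1
      · refine Finset.sum_congr rfl fun s hs => ?_
        rw [Finset.mem_range] at hs
        rw [← mul_assoc, ← pow_succ]
        congr 4
        omega
      · rw [← mul_assoc, ← pow_succ, show k + 1 - 1 - 0 + 1 = k + 1 by omega,
          residue_annihPoly_X_pow_mul hr, Finset.sum_smul]
        simp [hornerPoly, smul_smul, mul_comm]

end Horner

/-! ### Partial fractions of 1/P -/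

section PartialFractions

variable {r l : ℕ} {lam : Fin l → ℂ} {m : Fin l → ℕ}

/-- The product of the `(X - λ_t) ^ m_t` with `t ≠ i`. -/
def cofactor (lam : Fin l → ℂ) (m : Fin l → ℕ) (i : Fin l) : ℂ[X] :=
  ∏ t ∈ Finset.univ.erase i, (X - C (lam t)) ^ m t

lemma pow_mul_cofactor (lam : Fin l → ℂ) (m : Fin l → ℕ) (i : Fin l) :
    (X - C (lam i)) ^ m i * cofactor lam m i = ∏ t, (X - C (lam t)) ^ m t :=
  Finset.mul_prod_erase _ (fun t => (X - C (lam t)) ^ m t) (Finset.mem_univ i)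

lemma monic_cofactor (lam : Fin l → ℂ) (m : Fin l → ℕ) (i : Fin l) :
    (cofactor lam m i).Monic :=
  monic_prod_of_monic _ _ fun t _ => (monic_X_sub_C (lam t)).pow (m t)

/-- The polynomial which is `1` modulo `(X - λ_i) ^ m_i` and `0` modulo the other
`(X - λ_t) ^ m_t`. -/
def idempotentPoly (r : ℕ) (lam : Fin l → ℂ) (m : Fin l → ℕ) (i : Fin l) : ℂ[X] :=
  ∑ h ∈ Finset.range (m i),
    gammaCoeff r lam m i h • ((X - C (lam i)) ^ (m i - 1 - h) * cofactor lam m i)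

lemma cofactor_dvd_idempotentPoly (r : ℕ) (lam : Fin l → ℂ) (m : Fin l → ℕ) (i : Fin l) :
    cofactor lam m i ∣ idempotentPoly r lam m i :=
  Finset.dvd_sum fun _ _ => (dvd_mul_left _ _).trans (dvd_smul_of_dvd _ dvd_rfl)

/-- The convention for l = 1 is the general formula: there is a single empty family, and its sum is
0, which forces j = r - 1. -/
lemma gammaCoeff_eq_sum (hsum : ∑ i, m i = r) (i : Fin l) {j : ℕ} (hj : j < m i) :
    gammaCoeff r lam m i j = (-1) ^ (r - m i) *
      ∑ n ∈ Finset.piAntidiag (Finset.univ.erase i) (m i - j - 1),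
        ∏ t ∈ Finset.univ.erase i,
          ((n t + m t - 1).choose (n t) : ℂ) / (lam t - lam i) ^ (n t + m t) := by
  rw [gammaCoeff]
  split_ifs with hl hjr
  · subst hl
    have hmi : m i = r := by simpa [Subsingleton.elim i 0] using hsum
    rw [show m i - j - 1 = 0 by omega, hmi]
    simp [Subsingleton.elim i 0]
  · subst hl
    have hmi : m i = r := by simpa [Subsingleton.elim i 0] using hsum
    have : (Finset.univ.erase i : Finset (Fin 1)) = ∅ := by
      simp [Subsingleton.elim i 0]
    rw [this, Finset.piAntidiag_empty_of_ne_zero (by omega)]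
    simp
  · rfl

/-- The power series of `(X - δ) ^ (-k)`. -/
def invPowSeries (δ : ℂ) (k : ℕ) : PowerSeries ℂ :=
  PowerSeries.mk fun n => (-1) ^ k * (((n + k - 1).choose n : ℂ) / δ ^ (n + k))

lemma X_sub_C_pow_mul_invPowSeries {δ : ℂ} (hδ : δ ≠ 0) {k : ℕ} (hk : 1 ≤ k) :
    (PowerSeries.X - PowerSeries.C δ) ^ k * invPowSeries δ k = 1 := by
  obtain ⟨d, rfl⟩ := Nat.exists_eq_add_of_le' hk
  have h1 := congrArg (PowerSeries.rescale δ⁻¹)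
    (PowerSeries.mk_add_choose_mul_one_sub_pow_eq_one (S := ℂ) d)
  simp only [map_mul, map_pow, map_sub, map_one, PowerSeries.rescale_X] at h1
  have h2 : (PowerSeries.X - PowerSeries.C δ : PowerSeries ℂ) =
      PowerSeries.C (-δ) * (1 - PowerSeries.C δ⁻¹ * PowerSeries.X) := by
    rw [mul_sub, ← mul_assoc, ← map_mul]
    simp [hδ]
    ring
  have h3 : invPowSeries δ (d + 1) = PowerSeries.C ((-δ)⁻¹ ^ (d + 1)) *
      PowerSeries.rescale δ⁻¹ (PowerSeries.mk fun n => ((d + n).choose d : ℂ)) := by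
    ext n
    rw [PowerSeries.coeff_C_mul, PowerSeries.coeff_rescale, invPowSeries, PowerSeries.coeff_mk,
      PowerSeries.coeff_mk, show n + (d + 1) - 1 = d + n by omega, Nat.choose_symm_add,
      inv_neg, neg_pow δ⁻¹, pow_add δ n, inv_pow, inv_pow]
    field_simp
  rw [h2, h3, mul_pow, ← map_pow]
  calc _ = PowerSeries.C ((-δ) ^ (d + 1) * (-δ)⁻¹ ^ (d + 1)) *
        ((PowerSeries.rescale δ⁻¹ (PowerSeries.mk fun n => ((d + n).choose d : ℂ))) *
          (1 - PowerSeries.C δ⁻¹ * PowerSeries.X) ^ (d + 1)) := by rw [map_mul]; ring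
    _ = 1 := by
      rw [h1, ← mul_pow, mul_inv_cancel₀ (neg_ne_zero.2 hδ)]
      simp

lemma coeff_prod_invPowSeries (hsum : ∑ i, m i = r) (i : Fin l) {h : ℕ} (hh : h < m i) :
    PowerSeries.coeff (m i - 1 - h)
      (∏ t ∈ Finset.univ.erase i, invPowSeries (lam t - lam i) (m t)) =
      gammaCoeff r lam m i h := by
  have hr : r - m i = ∑ t ∈ Finset.univ.erase i, m t := by
    rw [← hsum, ← Finset.add_sum_erase _ m (Finset.mem_univ i), Nat.add_sub_cancel_left]
  rw [gammaCoeff_eq_sum hsum i hh, PowerSeries.coeff_prod, hr, Finset.mul_sum,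
    Nat.sub_right_comm]
  refine Finset.sum_equiv Finsupp.equivFunOnFinite (fun f => ?_) fun f _ => ?_
  · simp only [Finset.mem_finsuppAntidiag, Finset.mem_piAntidiag, Finset.subset_iff,
      Finsupp.mem_support_iff, Finsupp.equivFunOnFinite_apply]
  · simp only [invPowSeries, PowerSeries.coeff_mk, Finset.prod_mul_distrib,
      Finset.prod_pow_eq_pow_sum, Finsupp.equivFunOnFinite_apply]

/-- After translating λ_i to 0, the cofactor becomes Q with power series inverse R, and the γ's are
the first m_i coefficients of R. So G is the truncation of R, and G Q ≡ R Q = 1 modulo X^(m_i). -/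
lemma pow_dvd_idempotentPoly_sub_one (hsum : ∑ i, m i = r) (hlam : Function.Injective lam)
    (hm : ∀ i, 1 ≤ m i) (i : Fin l) :
    (X - C (lam i)) ^ m i ∣ idempotentPoly r lam m i - 1 := by
  rw [X_sub_C_pow_dvd_iff, Polynomial.X_pow_dvd_iff]
  set R : PowerSeries ℂ := ∏ t ∈ Finset.univ.erase i, invPowSeries (lam t - lam i) (m t) with hR
  set Q : PowerSeries ℂ := ∏ t ∈ Finset.univ.erase i,
    (PowerSeries.X - PowerSeries.C (lam t - lam i)) ^ m t with hQ
  set G : PowerSeries ℂ := ∑ h ∈ Finset.range (m i),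
    PowerSeries.C (gammaCoeff r lam m i h) * PowerSeries.X ^ (m i - 1 - h) with hG
  have hQR : R * Q = 1 := by
    rw [hR, hQ, ← Finset.prod_mul_distrib]
    refine Finset.prod_eq_one fun t ht => ?_
    rw [mul_comm]
    refine X_sub_C_pow_mul_invPowSeries ?_ (hm t)
    exact sub_ne_zero.2 fun h => Finset.ne_of_mem_erase ht (hlam h)
  have hcoe : (((idempotentPoly r lam m i - 1).comp (X + C (lam i)) : ℂ[X]) : PowerSeries ℂ) =
      G * Q - 1 := by
    have hc : ((cofactor lam m i).comp (X + C (lam i)) : ℂ[X]) =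
        ∏ t ∈ Finset.univ.erase i, (X - C (lam t - lam i)) ^ m t := by
      rw [cofactor, prod_comp]
      refine Finset.prod_congr rfl fun t _ => ?_
      simp only [pow_comp, sub_comp, X_comp, C_comp, C_sub]
      ring
    have hcQ : ((∏ t ∈ Finset.univ.erase i, (X - C (lam t - lam i)) ^ m t : ℂ[X]) :
        PowerSeries ℂ) = Q := by
      rw [← Polynomial.coeToPowerSeries.ringHom_apply, map_prod]
      simp [hQ]
    rw [idempotentPoly, sub_comp, Polynomial.sum_comp, one_comp,
      ← Polynomial.coeToPowerSeries.ringHom_apply, map_sub, map_sum, map_one, hG, Finset.sum_mul]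
    congr 1
    refine Finset.sum_congr rfl fun h _ => ?_
    simp only [smul_eq_C_mul, mul_comp, hc, pow_comp, sub_comp, X_comp, C_comp,
      add_sub_cancel_right]
    rw [map_mul, map_mul, map_pow]
    simp only [Polynomial.coeToPowerSeries.ringHom_apply, hcQ, Polynomial.coe_C, Polynomial.coe_X,
      mul_assoc]
  have hdvd : (PowerSeries.X : PowerSeries ℂ) ^ m i ∣ G * Q - 1 := by
    rw [← hQR, ← sub_mul]
    refine Dvd.dvd.mul_right ?_ Q
    rw [PowerSeries.X_pow_dvd_iff]
    intro d hd
    have hcd := coeff_prod_invPowSeries (lam := lam) hsum i (h := m i - 1 - d) (by omega)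
    rw [show m i - 1 - (m i - 1 - d) = d by omega] at hcd
    rw [map_sub, hcd, hG, map_sum, sub_eq_zero]
    simp only [PowerSeries.coeff_C_mul, PowerSeries.coeff_X_pow, mul_ite, mul_one, mul_zero]
    rw [Finset.sum_eq_single_of_mem (m i - 1 - d) (Finset.mem_range.2 (by omega))]
    · rw [if_pos (by omega)]
    · intro h hh hne
      rw [Finset.mem_range] at hh
      rw [if_neg (by omega)]
  intro d hd
  rw [← Polynomial.coeff_coe, hcoe]
  exact PowerSeries.X_pow_dvd_iff.1 hdvd d hd

/-- The difference of the two sides is divisible by each of the coprime factors of P, hence by P,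
and has smaller degree. -/
lemma sum_idempotentPoly (hl : Nonempty (Fin l)) (hsum : ∑ i, m i = r)
    (hlam : Function.Injective lam) (hm : ∀ i, 1 ≤ m i) :
    ∑ i, idempotentPoly r lam m i = 1 := by
  set P : ℂ[X] := ∏ t, (X - C (lam t)) ^ m t with hP
  have hmon : P.Monic := monic_prod_of_monic _ _ fun t _ => (monic_X_sub_C (lam t)).pow (m t)
  have hdeg : ∀ i, (idempotentPoly r lam m i).degree < P.degree := by
    intro i
    rw [degree_eq_natDegree hmon.ne_zero, ← mem_degreeLT, idempotentPoly]
    refine Submodule.sum_mem _ fun h hh => Submodule.smul_mem _ _ ?_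
    rw [mem_degreeLT, ← degree_eq_natDegree hmon.ne_zero, hP, ← pow_mul_cofactor lam m i,
      degree_mul, degree_mul]
    refine WithBot.add_lt_add_right (degree_ne_bot.2 (monic_cofactor lam m i).ne_zero) ?_
    rw [degree_pow, degree_pow, degree_X_sub_C]
    simp only [nsmul_eq_mul, mul_one]
    have := hm i
    exact_mod_cast (by omega : m i - 1 - h < m i)
  have hone : (1 : ℂ[X]).degree < P.degree := by
    obtain ⟨i⟩ := hl
    rw [hP, ← pow_mul_cofactor lam m i, degree_mul,
      degree_eq_natDegree (monic_cofactor lam m i).ne_zero, degree_pow, degree_X_sub_C, degree_one]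
    have := hm i
    simp only [nsmul_eq_mul, mul_one]
    exact_mod_cast (by omega : 0 < m i + (cofactor lam m i).natDegree)
  have hdvd : P ∣ ∑ i, idempotentPoly r lam m i - 1 := by
    refine Finset.prod_dvd_of_coprime (fun i _ j _ hij => ?_) fun i _ => ?_
    · exact IsCoprime.pow (pairwise_coprime_X_sub_C hlam hij)
    · rw [← Finset.add_sum_erase _ _ (Finset.mem_univ i), add_sub_right_comm]
      refine dvd_add (pow_dvd_idempotentPoly_sub_one hsum hlam hm i) (Finset.dvd_sum fun t ht => ?_)
      refine dvd_trans ?_ (cofactor_dvd_idempotentPoly r lam m t)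
      exact Finset.dvd_prod_of_mem (fun t => (X - C (lam t)) ^ m t)
        (Finset.mem_erase.2 ⟨(Finset.ne_of_mem_erase ht).symm, Finset.mem_univ i⟩)
  rw [← sub_eq_zero]
  refine eq_zero_of_dvd_of_degree_lt hdvd ?_
  refine lt_of_le_of_lt (degree_sub_le _ _) (max_lt ?_ hone)
  rw [degree_eq_natDegree hmon.ne_zero, ← mem_degreeLT]
  refine Submodule.sum_mem _ fun i _ => ?_
  rw [mem_degreeLT, ← degree_eq_natDegree hmon.ne_zero]
  exact hdeg i

end PartialFractions

/-! ### Binet's formula -/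

section Binet

lemma stirling_succ_succ (k j : ℕ) :
    stirling (k + 1) (j + 1) = stirling k j - k * stirling k (j + 1) := by
  simp only [stirling, Nat.stirlingFirst_succ_succ]
  push_cast
  ring

lemma stirling_eq_zero_of_lt {k j : ℕ} (h : k < j) : stirling k j = 0 := by
  simp [stirling, Nat.stirlingFirst_eq_zero_of_lt h]

lemma stirling_zero_right (k : ℕ) : stirling k 0 = if k = 0 then 1 else 0 := by
  cases k <;> simp [stirling]

lemma descPochhammer_eval_eq_sum_stirling (k : ℕ) (y : ℂ) :
    (descPochhammer ℂ k).eval y = ∑ j ∈ Finset.range (k + 1), stirling k j * y ^ j := by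
  induction k with
  | zero => simp [stirling_zero_right]
  | succ k ih =>
    have h1 : ∑ j ∈ Finset.range (k + 1), (k : ℂ) * stirling k (j + 1) * y ^ (j + 1) =
        ∑ j ∈ Finset.range (k + 1), stirling k j * y ^ j * k := by
      rw [Finset.sum_range_succ, stirling_eq_zero_of_lt (Nat.lt_succ_self k),
        Finset.sum_range_succ' (fun j => stirling k j * y ^ j * k), stirling_zero_right]
      have h0 : (if k = 0 then (1 : ℂ) else 0) * y ^ 0 * k = 0 := by
        split_ifs with h <;> simp [h]
      rw [h0, mul_zero, zero_mul]
      congr 1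
      exact Finset.sum_congr rfl fun j _ => by ring
    rw [descPochhammer_succ_eval, ih, Finset.sum_range_succ' (fun j => stirling (k + 1) j * y ^ j)]
    simp only [stirling_succ_succ, sub_mul, Finset.sum_sub_distrib]
    rw [h1, stirling_zero_right, if_neg (Nat.succ_ne_zero k), zero_mul, add_zero, mul_sub,
      Finset.sum_mul, Finset.sum_mul]
    congr 1
    exact Finset.sum_congr rfl fun j _ => by ring

lemma choose_eq_sum_stirling (k : ℕ) (y : ℂ) :
    Ring.choose y k = ∑ j ∈ Finset.range (k + 1), stirling k j / (k.factorial : ℂ) * y ^ j := by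
  have h : (descPochhammer ℤ k).smeval y = (descPochhammer ℂ k).eval y := by
    rw [← aeval_eq_smeval, ← eval_map_algebraMap, descPochhammer_map]
  rw [Ring.choose_eq_smul, h, descPochhammer_eval_eq_sum_stirling, Finset.smul_sum]
  exact Finset.sum_congr rfl fun j _ => by rw [smul_eq_mul]; ring

/-- Vandermonde's identity, expanded in powers of `N - R`. -/
lemma choose_eq_sum_choose_mul_stirling (N R h : ℕ) :
    (N.choose h : ℂ) = ∑ k ∈ Finset.range (h + 1), ∑ j ∈ Finset.range (k + 1),
      (R.choose (h - k) : ℂ) * (stirling k j / (k.factorial : ℂ)) * ((N : ℂ) - R) ^ j := by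
  have h1 := Ring.add_choose_eq h (Commute.all ((N : ℂ) - R) (R : ℂ))
  rw [sub_add_cancel, Ring.choose_natCast, Finset.Nat.sum_antidiagonal_eq_sum_range_succ
    (fun i j => Ring.choose ((N : ℂ) - R) i * Ring.choose (R : ℂ) j)] at h1
  rw [h1]
  refine Finset.sum_congr rfl fun k _ => ?_
  rw [choose_eq_sum_stirling, Ring.choose_natCast, Finset.sum_mul]
  exact Finset.sum_congr rfl fun j _ => by ring

variable {r l : ℕ} {lam : Fin l → ℂ} {m : Fin l → ℕ}

lemma sum_binetCoeff_mul_pow (i : Fin l) (hm : 1 ≤ m i) (y : ℂ) :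
    ∑ j ∈ Finset.range (m i), binetCoeff r lam m i j * y ^ j =
      ∑ h ∈ Finset.range (m i), lam i ^ (r - 1 - h) * gammaCoeff r lam m i h *
        ∑ k ∈ Finset.range (h + 1), ∑ j ∈ Finset.range (k + 1),
          ((r - 1).choose (h - k) : ℂ) * (stirling k j / (k.factorial : ℂ)) * y ^ j := by
  simp only [binetCoeff, Finset.sum_mul]
  rw [Finset.sum_comm' (t' := Finset.range (m i)) (s' := fun h => Finset.range (h + 1))]
  · refine Finset.sum_congr rfl fun h _ => ?_
    simp only [mul_assoc, ← Finset.mul_sum]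
    congr 2
    simp only [Finset.sum_mul]
    rw [Finset.sum_comm' (t' := Finset.range (h + 1)) (s' := fun k => Finset.range (k + 1))]
    · simp only [mul_assoc, Finset.mul_sum]
    · intro j k
      simp only [Finset.mem_range, Finset.mem_Icc]
      omega
  · intro j h
    simp only [Finset.mem_range, Finset.mem_Icc]
    omega

/-- In the term of index h, the factor shared with P cancels and leaves the denominator (X -
λ_i)^(h+1). -/
lemma residue_idempotentPoly_mul_X_pow (i : Fin l) (N : ℕ) :
    residue (∏ t, (X - C (lam t)) ^ m t) (idempotentPoly r lam m i * X ^ N) =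
      ∑ h ∈ Finset.range (m i),
        gammaCoeff r lam m i h * ((N.choose h : ℂ) * lam i ^ (N - h)) := by
  rw [idempotentPoly, Finset.sum_mul, map_sum]
  refine Finset.sum_congr rfl fun h hh => ?_
  rw [Finset.mem_range] at hh
  rw [smul_mul_assoc, map_smul, smul_eq_mul, ← residue_X_sub_C_pow_X_pow,
    ← pow_mul_cofactor lam m i]
  congr 1
  have hmon : ((X - C (lam i)) ^ (m i - 1 - h) * cofactor lam m i).Monic :=
    ((monic_X_sub_C _).pow _).mul (monic_cofactor lam m i)
  rw [← residue_mul_mul ((monic_X_sub_C (lam i)).pow (h + 1)) hmon, ← mul_assoc _ _ (cofactor _ _ _),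
    ← pow_add, show h + 1 + (m i - 1 - h) = m i by omega]
  rw [natDegree_pow, natDegree_X_sub_C]
  omega

/-- Binet's formula for one root, at the index `n - s` with `0 ≤ s < r`. -/
lemma residue_idempotentPoly_mul_X_pow_eq_binet (hsum : ∑ i, m i = r) (i : Fin l) (hm : 1 ≤ m i)
    (hlam : lam i ≠ 0) (n : ℕ) {s : ℕ} (hs : s < r) :
    residue (∏ t, (X - C (lam t)) ^ m t)
      (idempotentPoly r lam m i * X ^ (n + (r - 1 - s))) =
      (∑ j ∈ Finset.range (m i), binetCoeff r lam m i j * ((n : ℂ) - s) ^ j) *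
        (lam i ^ n / lam i ^ s) := by
  have hmr : m i ≤ r := hsum ▸ Finset.single_le_sum (fun _ _ => Nat.zero_le _) (Finset.mem_univ i)
  have hcast : ((n + (r - 1 - s) : ℕ) : ℂ) - ((r - 1 : ℕ) : ℂ) = (n : ℂ) - s := by
    obtain ⟨e, he⟩ := Nat.exists_eq_add_of_le (Nat.le_sub_one_of_lt hs)
    rw [he, Nat.add_sub_cancel_left]
    push_cast
    ring
  rw [residue_idempotentPoly_mul_X_pow, sum_binetCoeff_mul_pow i hm, Finset.sum_mul]
  refine Finset.sum_congr rfl fun h hh => ?_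
  rw [Finset.mem_range] at hh
  rw [← hcast, ← choose_eq_sum_choose_mul_stirling]
  -- The exponent N - h is truncated when N < h, but then binom(N,h) = 0. The exponent r - 1 - h
  -- never is, as h < m_i ≤ r.
  rcases lt_or_ge (n + (r - 1 - s)) h with hlt | hle
  · rw [Nat.choose_eq_zero_of_lt hlt]
    simp
  · have hpow : lam i ^ (n + (r - 1 - s) - h) = lam i ^ (r - 1 - h) * (lam i ^ n / lam i ^ s) := by
      rw [mul_div_assoc', eq_div_iff (pow_ne_zero _ hlam), ← pow_add, ← pow_add]
      congr 1
      omega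
    rw [hpow]
    ring

lemma binetCoeffTilde_eq_binetCoeff (hsum : ∑ i, m i = r) (i : Fin l) (hm : 1 ≤ m i) :
    binetCoeffTilde r lam m i = binetCoeff r lam m i 0 := by
  have hC : binetCoeff r lam m i 0 = ∑ h ∈ Finset.range (m i),
      lam i ^ (r - 1 - h) * gammaCoeff r lam m i h * ((r - 1).choose h : ℂ) := by
    rw [binetCoeff]
    refine Finset.sum_congr (Finset.ext fun h => ?_) fun h _ => ?_
    · simp only [Finset.mem_range, Finset.mem_Icc]
      omega
    · rw [Finset.sum_eq_single_of_mem 0 (by simp)]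
      · simp [stirling_zero_right]
      · intro k _ hk
        simp [stirling_zero_right, hk]
  rw [binetCoeffTilde, hC]
  split_ifs with hi
  · have hmi : m i = 1 := (Finset.mem_filter.1 hi).2
    rw [hmi, Finset.sum_range_one, gammaCoeff_eq_sum hsum i (by omega), hmi]
    simp
    ring
  · rfl

end Binet

/-! ### The binomial series and the operator D -/

section Series

lemma taylorCoeff_eq_choose (p n : ℕ) :
    taylorCoeff p n = (-1) ^ n * Ring.choose (1 / (p : ℂ)) n := by
  have h : (descPochhammer ℤ n).smeval (1 / (p : ℂ)) =
      (descPochhammer ℂ n).eval (1 / (p : ℂ)) := by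
    rw [← aeval_eq_smeval, ← eval_map_algebraMap, descPochhammer_map]
  rw [taylorCoeff, Ring.choose_eq_smul, h, descPochhammer_eval_eq_prod_range, smul_eq_mul]
  ring

lemma norm_taylorCoeff_le_one {p : ℕ} (hp : 1 ≤ p) (n : ℕ) : ‖taylorCoeff p n‖ ≤ 1 := by
  have hp1 : ‖1 / (p : ℂ)‖ ≤ 1 := by
    rw [norm_div, norm_one, Complex.norm_natCast]
    exact div_le_one_of_le₀ (by exact_mod_cast hp) (Nat.cast_nonneg p)
  rw [taylorCoeff, norm_div, norm_mul, norm_pow, norm_neg, norm_one, one_pow, one_mul, norm_prod,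
    Complex.norm_natCast, ← Finset.prod_range_add_one_eq_factorial]
  refine div_le_one_of_le₀ ?_ (Nat.cast_nonneg _)
  push_cast
  -- Each factor satisfies |1/p - q| ≤ q + 1, and these bounds multiply to n!.
  refine Finset.prod_le_prod (fun _ _ => norm_nonneg _) fun q _ => ?_
  refine (norm_sub_le _ _).trans ?_
  rw [Complex.norm_natCast, add_comm]
  gcongr

/-- The power series `∑ b n * n ^ k * z ^ n`. -/
def rootSeries (p k : ℕ) (z : ℂ) : ℂ := ∑' n : ℕ, taylorCoeff p n * (n : ℂ) ^ k * z ^ n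

lemma norm_rootSeries_term_le {p : ℕ} (hp : 1 ≤ p) (k n : ℕ) {z : ℂ} {ρ : ℝ} (hz : ‖z‖ ≤ ρ) :
    ‖taylorCoeff p n * (n : ℂ) ^ k * z ^ n‖ ≤ (n : ℝ) ^ k * ρ ^ n := by
  rw [norm_mul, norm_mul, norm_pow, norm_pow, Complex.norm_natCast]
  have := norm_taylorCoeff_le_one hp n
  calc _ ≤ 1 * (n : ℝ) ^ k * ρ ^ n := by gcongr
    _ = _ := by rw [one_mul]

lemma summable_pow_mul_pow (k : ℕ) {ρ : ℝ} (h0 : 0 ≤ ρ) (h1 : ρ < 1) :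
    Summable fun n : ℕ => (n : ℝ) ^ k * ρ ^ n :=
  summable_pow_mul_geometric_of_norm_lt_one k (by rwa [Real.norm_of_nonneg h0])

lemma hasSum_rootSeries {p : ℕ} (hp : 1 ≤ p) (k : ℕ) {z : ℂ} (hz : ‖z‖ < 1) :
    HasSum (fun n : ℕ => taylorCoeff p n * (n : ℂ) ^ k * z ^ n) (rootSeries p k z) :=
  (Summable.of_norm_bounded (summable_pow_mul_pow k (norm_nonneg z) hz)
    fun n => norm_rootSeries_term_le hp k n le_rfl).hasSum

lemma rootSeries_zero {p : ℕ} (hp : 1 ≤ p) {z : ℂ} (hz : ‖z‖ < 1) :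
    rootSeries p 0 z = (1 - z) ^ (1 / (p : ℂ)) := by
  have h := (Complex.one_add_cpow_hasFPowerSeriesOnBall_zero (a := 1 / (p : ℂ))).hasSum
    (y := -z) (by simpa [← ofReal_norm] using hz)
  refine (hasSum_rootSeries hp 0 hz).unique ?_
  have hterm : (fun n : ℕ => taylorCoeff p n * (n : ℂ) ^ 0 * z ^ n) =
      fun n : ℕ => binomialSeries ℂ (1 / (p : ℂ)) n fun _ => -z := by
    funext n
    rw [binomialSeries_apply, taylorCoeff_eq_choose]
    simp only [List.ofFn_const, List.prod_replicate, smul_eq_mul]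
    rw [neg_pow z]
    ring
  rw [zero_add] at h
  rwa [hterm, sub_eq_add_neg]

lemma differentiableAt_rootSeries {p : ℕ} (hp : 1 ≤ p) (k : ℕ) {z : ℂ} (hz : ‖z‖ < 1) :
    DifferentiableAt ℂ (rootSeries p k) z := by
  obtain ⟨ρ, hzρ, hρ⟩ := exists_between hz
  have h := Complex.differentiableOn_tsum_of_summable_norm
    (F := fun (n : ℕ) (w : ℂ) => taylorCoeff p n * (n : ℂ) ^ k * w ^ n)
    (summable_pow_mul_pow k ((norm_nonneg z).trans hzρ.le) hρ)
    (fun n => by fun_prop) (Metric.isOpen_ball (x := (0 : ℂ)) (ε := ρ))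
    (fun n w hw => norm_rootSeries_term_le hp k n (mem_ball_zero_iff.1 hw).le)
  exact h.differentiableAt (Metric.isOpen_ball.mem_nhds (mem_ball_zero_iff.2 hzρ))

lemma mul_deriv_rootSeries {p : ℕ} (hp : 1 ≤ p) (k : ℕ) {z : ℂ} (hz : ‖z‖ < 1) :
    z * deriv (rootSeries p k) z = rootSeries p (k + 1) z := by
  obtain ⟨ρ, hzρ, hρ⟩ := exists_between hz
  have h := Complex.hasSum_deriv_of_summable_norm
    (F := fun (n : ℕ) (w : ℂ) => taylorCoeff p n * (n : ℂ) ^ k * w ^ n)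
    (summable_pow_mul_pow k ((norm_nonneg z).trans hzρ.le) hρ)
    (fun n => by fun_prop) (Metric.isOpen_ball (x := (0 : ℂ)) (ε := ρ))
    (fun n w hw => norm_rootSeries_term_le hp k n (mem_ball_zero_iff.1 hw).le)
    (mem_ball_zero_iff.2 hzρ)
  refine (h.mul_left z).unique ?_
  refine (hasSum_rootSeries hp (k + 1) hz).congr_fun fun n => ?_
  rw [deriv_const_mul_field, deriv_pow_field]
  cases n with
  | zero => simp
  | succ n =>
    rw [Nat.add_sub_cancel]
    ring

lemma iterate_eulerOp_rootFun {p : ℕ} (hp : 1 ≤ p) (μ : ℂ) (k : ℕ) {t : ℝ}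
    (ht : ‖μ * (t : ℂ)‖ < 1) : (eulerOp^[k] (rootFun p μ)) t = rootSeries p k (μ * t) := by
  induction k generalizing t with
  | zero => rw [Function.iterate_zero_apply, rootSeries_zero hp ht, rootFun]
  | succ k ih =>
    -- Differentiation needs the induction hypothesis near t, not only at t; this is why t is
    -- generalized.
    have hev : eulerOp^[k] (rootFun p μ) =ᶠ[nhds t] fun s : ℝ => rootSeries p k (μ * s) := by
      have hc : Continuous fun s : ℝ => ‖μ * (s : ℂ)‖ := by fun_prop
      filter_upwards [hc.continuousAt.eventually_lt continuousAt_const ht] with s hs using ih hs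
    have hd : HasDerivAt (fun s : ℝ => rootSeries p k (μ * s))
        (deriv (rootSeries p k) (μ * t) * μ) t := by
      have h1 : HasDerivAt (fun s : ℂ => μ * s) μ (t : ℂ) := by
        simpa using (hasDerivAt_id (t : ℂ)).const_mul μ
      exact ((differentiableAt_rootSeries hp k ht).hasDerivAt.comp (t : ℂ) h1).comp_ofReal
    rw [Function.iterate_succ_apply', eulerOp, hev.deriv_eq, hd.deriv, ← mul_deriv_rootSeries hp k ht]
    ring

lemma hasSum_iterate_eulerOp_rootFun {p : ℕ} (hp : 1 ≤ p) (μ : ℂ) (k : ℕ) {t : ℝ}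
    (ht : ‖μ * (t : ℂ)‖ < 1) :
    HasSum (fun n : ℕ => taylorCoeff p n * (t : ℂ) ^ n * ((n : ℂ) ^ k * μ ^ n))
      ((eulerOp^[k] (rootFun p μ)) t) := by
  rw [iterate_eulerOp_rootFun hp μ k ht]
  refine (hasSum_rootSeries hp k ht).congr_fun fun n => ?_
  rw [mul_pow]
  ring

end Series

/-! ### Powers and the root series in an algebra where P vanishes -/

section Interpolation

variable {p r l : ℕ} {a : ℕ → ℂ} {lam : Fin l → ℂ} {m : Fin l → ℕ}

/-- The coefficient of `n ^ k * λ_i ^ n` in the `i`-th Binet term of `u (n - s)`. -/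
def shiftedBinetCoeff (r : ℕ) (lam : Fin l → ℂ) (m : Fin l → ℕ) (i : Fin l) (s k : ℕ) : ℂ :=
  ∑ j ∈ Finset.range (m i),
    binetCoeff r lam m i j / lam i ^ s * (j.choose k : ℂ) * (-(s : ℂ)) ^ (j - k)

lemma sum_binetCoeff_mul_sub_pow (i : Fin l) (n s : ℕ) :
    (∑ j ∈ Finset.range (m i), binetCoeff r lam m i j * ((n : ℂ) - s) ^ j) *
        (lam i ^ n / lam i ^ s) =
      ∑ k ∈ Finset.range (m i), (n : ℂ) ^ k * lam i ^ n * shiftedBinetCoeff r lam m i s k := by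
  simp only [shiftedBinetCoeff, Finset.mul_sum]
  rw [Finset.sum_comm, Finset.sum_mul]
  refine Finset.sum_congr rfl fun j hj => ?_
  rw [Finset.mem_range] at hj
  rw [sub_eq_add_neg, add_pow, Finset.mul_sum, Finset.sum_mul]
  refine Finset.sum_subset_zero_on_sdiff (fun k hk => ?_) (fun k hk => ?_) (fun k _ => ?_)
  · simp only [Finset.mem_range] at hk ⊢
    omega
  · simp only [Finset.mem_sdiff, Finset.mem_range, not_lt] at hk
    rw [Nat.choose_eq_zero_of_lt (by omega)]
    simp
  · ring

/-- The coefficient of `A_s` in the Binet-Hörner expression of `(1 - t A) ^ (1 / p)`. -/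
def hornerCoeff (p r : ℕ) (lam : Fin l → ℂ) (m : Fin l → ℕ) (s : ℕ) (t : ℝ) : ℂ :=
  ∑ i, ∑ k ∈ Finset.range (m i),
    shiftedBinetCoeff r lam m i s k * (eulerOp^[k] (rootFun p (lam i))) t

lemma simpleIdx_union_multipleIdx (hm : ∀ i, 1 ≤ m i) :
    simpleIdx m ∪ multipleIdx m = Finset.univ := by
  ext i
  have := hm i
  simp only [simpleIdx, multipleIdx, Finset.mem_union, Finset.mem_filter, Finset.mem_univ, true_and,
    iff_true]
  omega

lemma sum_multipleIdx_sum_Icc (hm : ∀ i, 1 ≤ m i) (F : Fin l → ℕ → ℂ) :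
    ∑ i, F i 0 + ∑ i ∈ multipleIdx m, ∑ j ∈ Finset.Icc 1 (m i - 1), F i j =
      ∑ i, ∑ j ∈ Finset.range (m i), F i j := by
  have h1 : ∑ i ∈ multipleIdx m, ∑ j ∈ Finset.Icc 1 (m i - 1), F i j =
      ∑ i, ∑ j ∈ Finset.Icc 1 (m i - 1), F i j := by
    refine Finset.sum_subset (Finset.subset_univ _) fun i _ hi => ?_
    simp only [multipleIdx, Finset.mem_filter, Finset.mem_univ, true_and, not_lt] at hi
    rw [Finset.Icc_eq_empty (by omega), Finset.sum_empty]
  rw [h1, ← Finset.sum_add_distrib]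
  refine Finset.sum_congr rfl fun i _ => ?_
  have hIcc : Finset.range (m i) = insert 0 (Finset.Icc 1 (m i - 1)) := by
    ext j
    have := hm i
    simp only [Finset.mem_range, Finset.mem_insert, Finset.mem_Icc]
    omega
  rw [hIcc, Finset.sum_insert (by simp)]

lemma hornerCoeff_eq_sum (s : ℕ) (t : ℝ) :
    hornerCoeff p r lam m s t = ∑ i, ∑ j ∈ Finset.range (m i), ∑ k ∈ Finset.range (j + 1),
      binetCoeff r lam m i j / lam i ^ s * (j.choose k : ℂ) * (-(s : ℂ)) ^ (j - k) *
        (eulerOp^[k] (rootFun p (lam i))) t := by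
  simp only [hornerCoeff, shiftedBinetCoeff, Finset.sum_mul]
  refine Finset.sum_congr rfl fun i _ => ?_
  rw [Finset.sum_comm]
  refine Finset.sum_congr rfl fun j hj => ?_
  rw [Finset.mem_range] at hj
  symm
  refine Finset.sum_subset (fun k hk => ?_) fun k _ hk => ?_
  · simp only [Finset.mem_range] at hk ⊢
    omega
  · rw [Finset.mem_range, not_lt] at hk
    rw [Nat.choose_eq_zero_of_lt (by omega)]
    simp

lemma bigPhi_add_bigPsi (hsum : ∑ i, m i = r) (hm : ∀ i, 1 ≤ m i) (s : ℕ) (t : ℝ) :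
    bigPhi p r lam m s t + bigPsi p r lam m s t = hornerCoeff p r lam m s t := by
  rw [hornerCoeff_eq_sum, bigPhi, bigPsi, simpleIdx_union_multipleIdx hm,
    ← sum_multipleIdx_sum_Icc hm]
  congr 1
  refine Finset.sum_congr rfl fun i _ => ?_
  simp [binetCoeffTilde_eq_binetCoeff hsum i (hm i)]

lemma phiZero_eq_hornerCoeff (hsum : ∑ i, m i = r) (hm : ∀ i, 1 ≤ m i) (t : ℝ) :
    phiZero p r lam m t = hornerCoeff p r lam m 0 t := by
  rw [← bigPhi_add_bigPsi hsum hm, phiZero, bigPhi, bigPsi]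
  congr 1
  · simp
  · refine Finset.sum_congr rfl fun i _ => Finset.sum_congr rfl fun j _ => ?_
    rw [Finset.sum_range_succ, Finset.sum_eq_zero, zero_add]
    · simp
    · intro k hk
      rw [Finset.mem_range] at hk
      rw [Nat.cast_zero, neg_zero, zero_pow (by omega), mul_zero, zero_mul]

/-- The polynomial in `A` which represents `(1 - t A) ^ (1 / p)`. -/
def binetHornerPoly (p r : ℕ) (lam : Fin l → ℂ) (m : Fin l → ℕ) (a : ℕ → ℂ) (t : ℝ) : ℂ[X] :=
  ∑ s ∈ Finset.range r, hornerCoeff p r lam m s t • hornerPoly a s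

lemma binetHornerMatrix_eq_aeval {d : ℕ} (A : Matrix (Fin d) (Fin d) ℂ) (hr : 1 ≤ r)
    (hsum : ∑ i, m i = r) (hm : ∀ i, 1 ≤ m i) (t : ℝ) :
    binetHornerMatrix p r lam m a A t = aeval A (binetHornerPoly p r lam m a t) := by
  have hrange : Finset.range r = insert 0 (Finset.Icc 1 (r - 1)) := by
    ext j
    simp only [Finset.mem_range, Finset.mem_insert, Finset.mem_Icc]
    omega
  rw [binetHornerMatrix, binetHornerPoly, map_sum, hrange, Finset.sum_insert (by simp),
    phiZero_eq_hornerCoeff hsum hm]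
  congr 1
  · simp [hornerPoly]
  · refine Finset.sum_congr rfl fun s _ => ?_
    rw [bigPhi_add_bigPsi hsum hm, map_smul, hornerMatrix]

/-- Linear functionals reduce this to a scalar polynomial having every natural number as a root. -/
lemma eq_zero_of_sum_natCast_pow_smul_eq_zero {V : Type*} [AddCommGroup V] [Module ℂ V] {N : ℕ}
    {G : ℕ → V} (h : ∀ n : ℕ, ∑ k ∈ Finset.range N, (n : ℂ) ^ k • G k = 0) {k : ℕ} (hk : k < N) :
    G k = 0 := by
  rw [← Module.forall_dual_apply_eq_zero_iff ℂ]
  intro φ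
  have hq : ∑ k ∈ Finset.range N, C (φ (G k)) * (X : ℂ[X]) ^ k = 0 := by
    refine Polynomial.eq_zero_of_infinite_isRoot _
      ((Set.infinite_range_of_injective Nat.cast_injective).mono ?_)
    rintro _ ⟨n, rfl⟩
    have := congrArg φ (h n)
    rw [map_sum, map_zero] at this
    rw [Set.mem_ofPred_eq, IsRoot.def, eval_finsetSum, ← this]
    refine Finset.sum_congr rfl fun k _ => ?_
    rw [eval_mul, eval_C, eval_pow, eval_X, map_smul, smul_eq_mul, mul_comm]
  have := congrArg (fun f => f.coeff k) hq
  simpa [finsetSum_coeff, coeff_C_mul, coeff_X_pow, hk] using this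

section Algebra

variable {𝔸 : Type*} [Ring 𝔸] [Algebra ℂ 𝔸] {x : 𝔸}

/-- The coefficient of `n ^ k * λ_i ^ n` in `x ^ n`. -/
def componentCoeff (r : ℕ) (lam : Fin l → ℂ) (m : Fin l → ℕ) (a : ℕ → ℂ) (x : 𝔸) (i : Fin l)
    (k : ℕ) : 𝔸 :=
  ∑ s ∈ Finset.range r, shiftedBinetCoeff r lam m i s k • aeval x (hornerPoly a s)

lemma aeval_binetHornerPoly (t : ℝ) :
    aeval x (binetHornerPoly p r lam m a t) = ∑ i, ∑ k ∈ Finset.range (m i),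
      (eulerOp^[k] (rootFun p (lam i))) t • componentCoeff r lam m a x i k := by
  simp only [binetHornerPoly, componentCoeff, hornerCoeff, map_sum, map_smul, Finset.sum_smul,
    Finset.smul_sum]
  rw [Finset.sum_comm]
  refine Finset.sum_congr rfl fun i _ => ?_
  rw [Finset.sum_comm]
  refine Finset.sum_congr rfl fun k _ => Finset.sum_congr rfl fun s _ => ?_
  rw [smul_smul, mul_comm]

lemma aeval_idempotentPoly_mul_X_pow (hr : 1 ≤ r) (hx : aeval x (annihPoly r a) = 0)
    (hsum : ∑ i, m i = r) (hm : ∀ i, 1 ≤ m i) (hlam0 : ∀ i, lam i ≠ 0)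
    (hfac : annihPoly r a = ∏ i, (X - C (lam i)) ^ m i) (i : Fin l) (n : ℕ) :
    aeval x (idempotentPoly r lam m i * X ^ n) =
      ∑ k ∈ Finset.range (m i), ((n : ℂ) ^ k * lam i ^ n) • componentCoeff r lam m a x i k := by
  rw [aeval_eq_sum_residue_smul_hornerPoly hr hx]
  simp only [componentCoeff, Finset.smul_sum]
  rw [Finset.sum_comm]
  refine Finset.sum_congr rfl fun s hs => ?_
  rw [Finset.mem_range] at hs
  rw [mul_left_comm, ← pow_add, add_comm, hfac,
    residue_idempotentPoly_mul_X_pow_eq_binet hsum i (hm i) (hlam0 i) n hs,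
    sum_binetCoeff_mul_sub_pow, Finset.sum_smul]
  simp only [smul_smul]

/-- Off the spectrum x - λ_i is a unit, so it cancels from P(x) = 0 and the cofactor already
vanishes at x. -/
lemma aeval_idempotentPoly_eq_zero (hx : aeval x (annihPoly r a) = 0)
    (hfac : annihPoly r a = ∏ i, (X - C (lam i)) ^ m i) {i : Fin l}
    (hi : lam i ∉ spectrum ℂ x) : aeval x (idempotentPoly r lam m i) = 0 := by
  obtain ⟨q, hq⟩ := cofactor_dvd_idempotentPoly r lam m i
  have hu : IsUnit (x - algebraMap ℂ 𝔸 (lam i)) := by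
    rw [← neg_sub, IsUnit.neg_iff]
    exact spectrum.notMem_iff.1 hi
  have h0 : aeval x (cofactor lam m i) = 0 := by
    rw [hfac, ← pow_mul_cofactor lam m i, map_mul] at hx
    have h1 : aeval x ((X - C (lam i)) ^ m i) = (x - algebraMap ℂ 𝔸 (lam i)) ^ m i := by simp
    rw [h1] at hx
    exact ((hu.pow (m i)).mul_right_eq_zero).1 hx
  rw [hq, map_mul, h0, zero_mul]

/-- For such λ_i the derivatives of the root function are multiplied by 0, so neither their values
nor the size of λ_i t matters, even at λ_i t = 1. -/
lemma componentCoeff_eq_zero (hr : 1 ≤ r) (hx : aeval x (annihPoly r a) = 0)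
    (hsum : ∑ i, m i = r) (hm : ∀ i, 1 ≤ m i) (hlam0 : ∀ i, lam i ≠ 0)
    (hfac : annihPoly r a = ∏ i, (X - C (lam i)) ^ m i) {i : Fin l}
    (hi : lam i ∉ spectrum ℂ x) {k : ℕ} (hk : k < m i) :
    componentCoeff r lam m a x i k = 0 := by
  refine eq_zero_of_sum_natCast_pow_smul_eq_zero (N := m i) (fun n => ?_) hk
  have h := aeval_idempotentPoly_mul_X_pow hr hx hsum hm hlam0 hfac i n
  rw [map_mul, aeval_idempotentPoly_eq_zero hx hfac hi, zero_mul] at h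
  simp only [mul_comm _ (lam i ^ n), mul_smul, ← Finset.smul_sum] at h
  exact ((smul_eq_zero_iff_right (pow_ne_zero n (hlam0 i))).1 h.symm)

lemma pow_eq_sum_componentCoeff (hr : 1 ≤ r) (hx : aeval x (annihPoly r a) = 0)
    (hsum : ∑ i, m i = r) (hm : ∀ i, 1 ≤ m i) (hlam : Function.Injective lam)
    (hlam0 : ∀ i, lam i ≠ 0)
    (hfac : annihPoly r a = ∏ i, (X - C (lam i)) ^ m i) (n : ℕ) :
    x ^ n = ∑ i, ∑ k ∈ Finset.range (m i),
      ((n : ℂ) ^ k * lam i ^ n) • componentCoeff r lam m a x i k := by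
  have hl : Nonempty (Fin l) := by
    by_contra h
    rw [not_nonempty_iff] at h
    rw [Finset.univ_eq_empty, Finset.sum_empty] at hsum
    omega
  simp only [← aeval_idempotentPoly_mul_X_pow hr hx hsum hm hlam0 hfac]
  rw [← map_sum, ← Finset.sum_mul, sum_idempotentPoly hl hsum hlam hm, one_mul, map_pow, aeval_X]

/-- The algebra is left general because both the matrix algebra, at A, and ℂ, at an eigenvalue of A,
are used. -/
lemma hasSum_taylorCoeff_smul_pow [TopologicalSpace 𝔸] [ContinuousAdd 𝔸] [ContinuousSMul ℂ 𝔸]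
    (hp : 1 ≤ p) (hr : 1 ≤ r) (hx : aeval x (annihPoly r a) = 0)
    (hsum : ∑ i, m i = r) (hm : ∀ i, 1 ≤ m i) (hlam : Function.Injective lam)
    (hlam0 : ∀ i, lam i ≠ 0)
    (hfac : annihPoly r a = ∏ i, (X - C (lam i)) ^ m i) {t : ℝ}
    (ht : ∀ i, lam i ∈ spectrum ℂ x → ‖lam i * (t : ℂ)‖ < 1) :
    HasSum (fun n : ℕ => (taylorCoeff p n * (t : ℂ) ^ n) • x ^ n)
      (aeval x (binetHornerPoly p r lam m a t)) := by
  rw [aeval_binetHornerPoly]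
  simp only [pow_eq_sum_componentCoeff hr hx hsum hm hlam hlam0 hfac, Finset.smul_sum, smul_smul]
  refine hasSum_sum fun i _ => hasSum_sum fun k hk => ?_
  by_cases hi : lam i ∈ spectrum ℂ x
  · exact (hasSum_iterate_eulerOp_rootFun hp (lam i) k (ht i hi)).smul_const _
  · rw [componentCoeff_eq_zero hr hx hsum hm hlam0 hfac hi (Finset.mem_range.1 hk)]
    simp only [smul_zero]
    exact hasSum_zero

end Algebra

end Interpolation

/-! ### The pth power and the sector of the eigenvalues -/

section PrincipalRoot

lemma hasSum_coeff_pow_smul_pow {𝔸 : Type*} [NormedRing 𝔸] [NormedAlgebra ℂ 𝔸]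
    [FiniteDimensional ℂ 𝔸] {B : PowerSeries ℂ} {y Y : 𝔸}
    (h : HasSum (fun n => PowerSeries.coeff n B • y ^ n) Y) (q : ℕ) :
    HasSum (fun n => PowerSeries.coeff n (B ^ q) • y ^ n) (Y ^ q) := by
  -- In finite real dimension summability is absolute, which legitimates the Cauchy products below.
  let : NormedSpace ℝ 𝔸 := NormedSpace.restrictScalars ℝ ℂ 𝔸
  have : IsScalarTower ℝ ℂ 𝔸 := IsScalarTower.of_algebraMap_smul fun _ _ => rfl
  have : FiniteDimensional ℝ 𝔸 := FiniteDimensional.trans ℝ ℂ 𝔸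
  have : CompleteSpace 𝔸 := FiniteDimensional.complete ℂ 𝔸
  induction q with
  | zero =>
    have := hasSum_single (f := fun n => PowerSeries.coeff n (B ^ 0) • y ^ n) 0 fun n hn => by
      simp [PowerSeries.coeff_one, hn]
    simpa using this
  | succ q ih =>
    have h1 := summable_norm_iff.2 ih.summable
    have h2 := summable_norm_iff.2 h.summable
    have hprod := tsum_mul_tsum_eq_tsum_sum_antidiagonal_of_summable_norm h1 h2
    have hsum := (summable_norm_sum_mul_antidiagonal_of_summable_norm h1 h2).of_norm.hasSum
    rw [← hprod, ih.tsum_eq, h.tsum_eq, ← pow_succ] at hsum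
    refine hsum.congr_fun fun n => ?_
    rw [pow_succ B, PowerSeries.coeff_mul, Finset.sum_smul]
    refine Finset.sum_congr rfl fun k hk => ?_
    rw [smul_mul_smul_comm, ← pow_add, Finset.HasAntidiagonal.mem_antidiagonal.1 hk]

/-- Binomial series multiply by adding exponents, and p · (1/p) = 1. -/
lemma mk_taylorCoeff_pow {p : ℕ} (hp : p ≠ 0) :
    (PowerSeries.mk (taylorCoeff p)) ^ p = 1 - PowerSeries.X := by
  have h1 : PowerSeries.mk (taylorCoeff p) =
      PowerSeries.rescale (-1) (PowerSeries.binomialSeries ℂ (1 / (p : ℂ))) := by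
    ext n
    rw [PowerSeries.coeff_mk, PowerSeries.coeff_rescale, PowerSeries.binomialSeries_coeff,
      taylorCoeff_eq_choose, smul_eq_mul, mul_one]
  have h2 : ∀ q : ℕ, PowerSeries.binomialSeries ℂ (1 / (p : ℂ)) ^ q =
      PowerSeries.binomialSeries ℂ ((q : ℂ) * (1 / (p : ℂ))) := by
    intro q
    induction q with
    | zero => simp
    | succ q ih => rw [pow_succ, ih, ← PowerSeries.binomialSeries_add, Nat.cast_succ, add_one_mul]
  have h3 := PowerSeries.binomialSeries_nat (R := ℂ) (A := ℂ) 1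
  rw [Nat.cast_one, pow_one] at h3
  rw [h1, ← map_pow, h2, mul_one_div_cancel (Nat.cast_ne_zero.2 hp), h3, map_add, map_one,
    PowerSeries.rescale_X]
  simp [sub_eq_add_neg]

lemma pow_eq_one_sub_of_hasSum {𝔸 : Type*} [NormedRing 𝔸] [NormedAlgebra ℂ 𝔸]
    [FiniteDimensional ℂ 𝔸] {p : ℕ} (hp : p ≠ 0) {y Y : 𝔸}
    (h : HasSum (fun n => taylorCoeff p n • y ^ n) Y) : Y ^ p = 1 - y := by
  have h1 := hasSum_coeff_pow_smul_pow (B := PowerSeries.mk (taylorCoeff p)) (y := y) (Y := Y)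
    (by simpa only [PowerSeries.coeff_mk] using h) p
  rw [mk_taylorCoeff_pow hp] at h1
  refine h1.unique ?_
  have hcoeff : ∀ n, PowerSeries.coeff n (1 - PowerSeries.X : PowerSeries ℂ) =
      (if n = 0 then 1 else 0) - if n = 1 then 1 else 0 := fun n => by
    rw [map_sub, PowerSeries.coeff_one, PowerSeries.coeff_X]
  have h2 : HasSum (fun n => PowerSeries.coeff n (1 - PowerSeries.X : PowerSeries ℂ) • y ^ n)
      (∑ n ∈ Finset.range 2, PowerSeries.coeff n (1 - PowerSeries.X : PowerSeries ℂ) • y ^ n) := by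
    refine hasSum_sum_of_ne_finset_zero fun n hn => ?_
    rw [Finset.mem_range, not_lt] at hn
    rw [hcoeff, if_neg (by omega), if_neg (by omega), sub_zero, zero_smul]
  convert h2 using 1
  simp [Finset.sum_range_succ, sub_eq_add_neg]

/-- The number 1 - w lies in the right half-plane, so |arg(1 - w)| < π; the principal power divides
this argument by p without leaving the principal branch. -/
lemma abs_arg_one_sub_cpow_lt {p : ℕ} (hp : 1 ≤ p) {w : ℂ} (hw : ‖w‖ < 1) :
    (1 - w) ^ (1 / (p : ℂ)) ≠ 0 ∧
      |Complex.arg ((1 - w) ^ (1 / (p : ℂ)))| < Real.pi / p := by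
  have hre : 0 < (1 - w).re := by
    have := (Complex.abs_re_le_norm w).trans_lt hw
    rw [Complex.sub_re, Complex.one_re]
    linarith [(abs_lt.1 this).2]
  have h0 : 1 - w ≠ 0 := by
    intro h
    rw [h, Complex.zero_re] at hre
    exact lt_irrefl _ hre
  have hp0 : (0 : ℝ) < p := by exact_mod_cast hp
  have hpi := Real.pi_pos
  have harg : |Complex.arg (1 - w)| < Real.pi := by
    refine (Complex.abs_arg_lt_pi_div_two_iff.2 (Or.inl hre)).trans ?_
    linarith
  have him : (Complex.log (1 - w) * (1 / (p : ℂ))).im = Complex.arg (1 - w) / p := by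
    rw [mul_one_div, Complex.div_natCast_im, Complex.log_im]
  have hlt : |Complex.arg (1 - w) / p| < Real.pi / p := by
    rw [abs_div, Nat.abs_cast]
    exact div_lt_div_of_pos_right harg hp0
  have hle : Real.pi / p ≤ Real.pi := div_le_self hpi.le (by exact_mod_cast hp)
  rw [Complex.cpow_def_of_ne_zero h0]
  refine ⟨Complex.exp_ne_zero _, ?_⟩
  rw [← Complex.log_im, Complex.log_exp, him]
  · exact hlt
  · rw [him]
    linarith [(abs_lt.1 hlt).1]
  · rw [him]
    linarith [(abs_lt.1 hlt).2]

lemma norm_mul_lt_one_of_spectralRadius {𝔸 : Type*} [Ring 𝔸] [Algebra ℂ 𝔸] {x : 𝔸} {t : ℝ}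
    (ht : ENNReal.ofReal |t| * spectralRadius ℂ x < 1) {μ : ℂ} (hμ : μ ∈ spectrum ℂ x) :
    ‖μ * (t : ℂ)‖ < 1 := by
  have h1 : (‖μ‖₊ : ENNReal) ≤ spectralRadius ℂ x :=
    le_iSup₂ (f := fun (k : ℂ) (_ : k ∈ spectrum ℂ x) => (‖k‖₊ : ENNReal)) μ hμ
  have h2 : ENNReal.ofReal |t| * ‖μ‖₊ < 1 := (by gcongr : _ ≤ _).trans_lt ht
  have h3 : ((‖μ‖₊ : NNReal) : ENNReal) = ENNReal.ofReal ‖μ‖ := (ofReal_norm μ).symm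
  rw [h3, ← ENNReal.ofReal_mul (abs_nonneg t), ENNReal.ofReal_lt_one] at h2
  rwa [norm_mul, Complex.norm_real, Real.norm_eq_abs, mul_comm]

lemma eval_eq_zero_of_mem_spectrum {𝔸 : Type*} [Ring 𝔸] [Algebra ℂ 𝔸] [Nontrivial 𝔸] {x : 𝔸}
    {f : ℂ[X]} (hx : aeval x f = 0) {μ : ℂ} (hμ : μ ∈ spectrum ℂ x) : f.eval μ = 0 := by
  have h := spectrum.subset_polynomial_aeval x f ⟨μ, hμ, rfl⟩
  rwa [hx, spectrum.zero_eq] at h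

end PrincipalRoot

end

end PthRoot

/-! ### The main theorem -/

theorem theorem2p4 (d p r l : ℕ) (hp : 2 ≤ p) (hr : 1 ≤ r)
    (A : Matrix (Fin d) (Fin d) ℂ) (a : ℕ → ℂ) (ha : a (r - 1) ≠ 0)
    (hA : Polynomial.aeval A (PthRoot.annihPoly r a) = 0)
    (lam : Fin l → ℂ) (m : Fin l → ℕ) (hlam : Function.Injective lam) (hm : ∀ i, 1 ≤ m i)
    (hfac : PthRoot.annihPoly r a =
      ∏ i : Fin l, (Polynomial.X - Polynomial.C (lam i)) ^ m i) :
    (∀ n : ℕ, PthRoot.fibSeq r a n =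
      ∑ i : Fin l, ∑ j ∈ Finset.range (m i),
        PthRoot.binetCoeff r lam m i j * (n : ℂ) ^ j * lam i ^ n) ∧
    (∀ i : Fin l, PthRoot.binetCoeffTilde r lam m i = PthRoot.binetCoeff r lam m i 0) ∧
    ∀ t : ℝ, t ≠ 0 → ENNReal.ofReal |t| * spectralRadius ℂ A < 1 →
      HasSum (fun n : ℕ => (PthRoot.taylorCoeff p n * (t : ℂ) ^ n) • A ^ n)
        (PthRoot.binetHornerMatrix p r lam m a A t) ∧
      PthRoot.IsPrincipalRoot p (1 - (t : ℂ) • A)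
        (PthRoot.binetHornerMatrix p r lam m a A t) := by
  have hp1 : 1 ≤ p := by omega
  have hsum : ∑ i, m i = r := by
    have h := PthRoot.natDegree_annihPoly (a := a) hr
    rw [hfac, Polynomial.natDegree_prod_of_monic _ _
      fun i _ => (Polynomial.monic_X_sub_C (lam i)).pow (m i)] at h
    simpa using h
  have hlam0 : ∀ i, lam i ≠ 0 := by
    intro i hi
    have h0 : (PthRoot.annihPoly r a).eval 0 = 0 := by
      rw [hfac, Polynomial.eval_prod]
      exact Finset.prod_eq_zero (Finset.mem_univ i) (by simp [hi, (Nat.one_le_iff_ne_zero.1 (hm i))])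
    obtain ⟨k, rfl⟩ := Nat.exists_eq_add_of_le' hr
    rw [← PthRoot.hornerPoly_eq_annihPoly, PthRoot.hornerPoly] at h0
    simp at h0
    exact ha h0
  have hl : Nonempty (Fin l) := by
    by_contra h
    rw [not_nonempty_iff] at h
    rw [Finset.univ_eq_empty, Finset.sum_empty] at hsum
    omega
  refine ⟨fun n => ?_, fun i => PthRoot.binetCoeffTilde_eq_binetCoeff hsum i (hm i),
    fun t _ ht => ?_⟩
  · rw [PthRoot.fibSeq_eq_residue hr, ← one_mul (Polynomial.X ^ _),
      ← PthRoot.sum_idempotentPoly hl hsum hlam hm, Finset.sum_mul, map_sum, hfac]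
    refine Finset.sum_congr rfl fun i _ => ?_
    have h := PthRoot.residue_idempotentPoly_mul_X_pow_eq_binet hsum i (hm i) (hlam0 i) n
      (s := 0) (by omega)
    rw [show n + r - 1 = n + (r - 1 - 0) by omega, h, Finset.sum_mul]
    simp
  · rw [PthRoot.binetHornerMatrix_eq_aeval A hr hsum hm]
    have hS := PthRoot.hasSum_taylorCoeff_smul_pow hp1 hr hA hsum hm hlam hlam0 hfac (t := t)
      fun i hi => PthRoot.norm_mul_lt_one_of_spectralRadius ht hi
    refine ⟨hS, ?_, fun z hz => ?_⟩
    · let : NormedRing (Matrix (Fin d) (Fin d) ℂ) := Matrix.linftyOpNormedRing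
      let : NormedAlgebra ℂ (Matrix (Fin d) (Fin d) ℂ) := Matrix.linftyOpNormedAlgebra
      refine PthRoot.pow_eq_one_sub_of_hasSum (by omega) ?_
      simp only [smul_pow, smul_smul]
      exact hS
    · cases subsingleton_or_nontrivial (Matrix (Fin d) (Fin d) ℂ) with
      | inl h => exact absurd hz (by rw [spectrum.of_subsingleton]; exact Set.notMem_empty z)
      | inr h =>
        rw [spectrum.map_polynomial_aeval_of_nonempty _ _
          (spectrum.nonempty_of_isAlgClosed_of_finiteDimensional ℂ A)] at hz
        obtain ⟨μ, hμ, rfl⟩ := hz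
        have hlt := PthRoot.norm_mul_lt_one_of_spectralRadius ht hμ
        have hroot : Polynomial.aeval μ (PthRoot.annihPoly r a) = 0 := by
          rw [Polynomial.coe_aeval_eq_eval]
          exact PthRoot.eval_eq_zero_of_mem_spectrum hA hμ
        -- In the algebra ℂ the spectrum of μ is {μ}, so the convergence condition concerns μ alone.
        have hμS := PthRoot.hasSum_taylorCoeff_smul_pow hp1 hr hroot hsum hm hlam hlam0 hfac
          (t := t) fun i hi => by
            have hi' : lam i = μ := by
              by_contra hne
              exact hi (sub_ne_zero.2 hne).isUnit
            rwa [hi']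
        have hval := hμS.unique ((PthRoot.hasSum_iterate_eulerOp_rootFun hp1 μ 0 hlt).congr_fun
          fun n => by simp)
        rw [Polynomial.coe_aeval_eq_eval] at hval
        simp only [hval, Function.iterate_zero_apply, PthRoot.rootFun]
        exact PthRoot.abs_arg_one_sub_cpow_lt hp1 hlt
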